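/- Let $(V,\otimes,k)$ be a commutative unital quantale, with internal hom $\hom(u,-)$ right adjoint to $u\otimes -$. A $V$-category is a set $X$ with a map $a\colon X\times X\to V$ such that $k\le a(x,x)$ and $a(x,y)\otimes a(y,z)\le a(x,z)$; a $V$-functor $f\colon(X,a)\to(Y,b)$ is a map with $a(x,x')\le b(f(x),f(x'))$. The category of $V$-categories and $V$-functors is $V\text{-}\mathsf{Cat}$. A $V$-category $X$ is *separated* if $k\le a(x,y)$ and $k\le a(y,x)$ imply $x=y$; it is *Cauchy-complete* if every adjunction $\varphi\dashv\psi$ of $V$-distributors (modules), $\varphi$ from $Y$ to $X$ and $\psi$ from $X$ to $Y$, is of the form $f_*\dashv f^*$ for some $V$-functor $f\colon Y\to X$. A $V$-category is *ccd* if its Yoneda embedding has a left adjoint which itself has a left adjoint. The ccd $V$-categories, with the $V$-functors that preserve weighted limits and weighted colimits as homomorphisms, play the role of the variety; in particular the powers $V^X$ of $(V,\hom)$ are ccd. An *affine set* $(X,S)$ is a set $X$ with a subalgebra $S$ of $V^X$, that is, a set $S$ of functions $X\to V$ which, with the $V$-category structure induced from $V^X$, is ccd and whose inclusion into $V^X$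 preserves weighted limits and weighted colimits. A morphism $(X,S)\to(Y,T)$ of affine sets is a map $f\colon X\to Y$ with $\varphi\circ f\in S$ for all $\varphi\in T$; this defines the category $\mathsf{AfSet}(V)$. The *Zariski closure* of $M\subseteq X$ in $(X,S)$ is the intersection of all equalizers $\mathrm{Eq}(\varphi,\psi)$ with $\varphi,\psi\in S$ and $M\subseteq\mathrm{Eq}(\varphi,\psi)$. The affine set $(X,S)$ is *separated* if for all $x\ne y$ in $X$ there is $\varphi\in S$ with $\varphi(x)\neq\varphi(y)$; it is *algebraic* if it is separated and, for every embedding $i\colon(X,S)\to(Y,T)$ into a separated affine set (that is, $i$ is injective and $S=\{\varphi\circ i\mid\varphi\in T\}$), the image $i(X)$ equals its Zariski closure in $(Y,T)$. Let $F\colon V\text{-}\mathsf{Cat}\to\mathsf{AfSet}(V)$ be the functor sending $X$ to $(X,V\text{-}\mathsf{Cat}(X,V))$, and let $G\colon\mathsf{AfSet}(V)\to V\text{-}\mathsf{Cat}$ be the functor sending $(X,S)$ to $X$ with the initial structure $a(x,y)=\bigwedge_{\varphi\in S}\hom(\varphi(x),\varphi(y))$, both identical on morphisms. **Proposition.** The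 functors $F$ and $G$ are mutually inverse isomorphisms of categories, and under this isomorphism an affine set $(X,S)$ is algebraic if and only if the corresponding $V$-category $G(X,S)$ is separated and Cauchy-complete. Moreover, the full subcategory $V\text{-}\mathsf{Cat}_{\mathrm{sep},\mathrm{cc}}$ of $V\text{-}\mathsf{Cat}$ defined by the separated and Cauchy-complete $V$-categories is dually equivalent to a quasivariety over $\mathsf{Set}$, that is, its dual is equivalent to a regular epireflective full subcategory of a category monadic over $\mathsf{Set}$. -/

import Mathlib

open CategoryTheory
open scoped Quantale

universe u v w

/-- A small category enriched in the commutative unital quantale `V`, with tensor `*` and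
unit `1`. -/
structure VCat (V : Type u) [CommMonoid V] [CompleteLattice V] [IsQuantale V] where
  carrier : Type u
  hom : carrier → carrier → V
  one_le : ∀ x, 1 ≤ hom x x
  comp_le : ∀ x y z, hom x y * hom y z ≤ hom x z

section

variable {V : Type u} [CommMonoid V] [CompleteLattice V] [IsQuantale V]

/-- Residuation adjunction: the internal hom `y ⇨ᵣ z` of `V` is right adjoint to `y * -`. -/
theorem le_res_iff {x y z : V} : x ≤ y ⇨ᵣ z ↔ y * x ≤ z :=
  Quantale.rightMulResiduation_le_iff_mul_le

theorem one_le_res (x : V) : 1 ≤ x ⇨ᵣ x := by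
  rw [le_res_iff, mul_one]

theorem mul_res_le (x y : V) : x * (x ⇨ᵣ y) ≤ y := le_res_iff.1 le_rfl

theorem res_comp (x y z : V) : (x ⇨ᵣ y) * (y ⇨ᵣ z) ≤ x ⇨ᵣ z := by
  rw [le_res_iff, ← mul_assoc]
  exact (mul_le_mul_left (mul_res_le x y) _).trans (mul_res_le y z)

namespace VCat

/-- `V`-functors. -/
def IsVFunctor (X Y : VCat V) (f : X.carrier → Y.carrier) : Prop :=
  ∀ x x', X.hom x x' ≤ Y.hom (f x) (f x')

/-- Morphisms of the category of `V`-categories. -/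
@[ext]
structure Hom (X Y : VCat V) where
  toFun : X.carrier → Y.carrier
  isVFunctor : IsVFunctor X Y toFun

instance : Category (VCat V) where
  Hom := Hom
  id X := ⟨id, fun _ _ => le_rfl⟩
  comp f g := ⟨g.toFun ∘ f.toFun, fun x x' => (f.isVFunctor x x').trans (g.isVFunctor _ _)⟩

/-- Separated (skeletal) `V`-categories. -/
def IsSeparated (X : VCat V) : Prop :=
  ∀ x y : X.carrier, 1 ≤ X.hom x y → 1 ≤ X.hom y x → x = y

/-- `V`-distributors (also called modules, or profunctors) `X ⇸ Y`. -/
def IsDistributor (X Y : VCat V) (φ : X.carrier → Y.carrier → V) : Prop :=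
  (∀ x' x y, X.hom x' x * φ x y ≤ φ x' y) ∧ (∀ x y y', φ x y * Y.hom y y' ≤ φ x y')

/-- An adjunction `φ ⊣ ψ` of distributors `φ : Y ⇸ X` and `ψ : X ⇸ Y`: the unit
`1_Y ≤ ψ ∘ φ` and the counit `φ ∘ ψ ≤ 1_X`. -/
def IsDistAdjunction (Y X : VCat V) (φ : Y.carrier → X.carrier → V)
    (ψ : X.carrier → Y.carrier → V) : Prop :=
  IsDistributor Y X φ ∧ IsDistributor X Y ψ ∧
  (∀ y y', Y.hom y y' ≤ ⨆ x, φ y x * ψ x y') ∧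
  (∀ x x', ⨆ y, ψ x y * φ y x' ≤ X.hom x x')

/-- Cauchy completeness: every adjunction `φ ⊣ ψ` of distributors with `φ : Y ⇸ X` is
`f_* ⊣ f^*` for some `V`-functor `f : Y → X`. -/
def IsCauchyComplete (X : VCat V) : Prop :=
  ∀ (Y : VCat V) (φ : Y.carrier → X.carrier → V) (ψ : X.carrier → Y.carrier → V),
    IsDistAdjunction Y X φ ψ → ∃ f : Y ⟶ X,
      (∀ y x, φ y x = X.hom (f.toFun y) x) ∧ (∀ x y, ψ x y = X.hom x (f.toFun y))

/-- The property of `V`-categories of being separated and Cauchy-complete. -/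
def isSepCC (V : Type u) [CommMonoid V] [CompleteLattice V] [IsQuantale V] :
    ObjectProperty (VCat V) :=
  fun X => X.IsSeparated ∧ X.IsCauchyComplete

/-- The `V`-category of presheaves on `X`, that is, of distributors from `X` to the
one-object `V`-category. -/
def presheaf (X : VCat V) : VCat V where
  carrier := {p : X.carrier → V // ∀ x y, X.hom x y * p y ≤ p x}
  hom p q := ⨅ x, p.1 x ⇨ᵣ q.1 x
  one_le _ := le_iInf fun _ => one_le_res _
  comp_le _ _ _ := le_iInf fun x =>
    (mul_le_mul' (iInf_le _ x) (iInf_le _ x)).trans (res_comp _ _ _)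

/-- The Yoneda embedding `x ↦ X(-, x)`. -/
def yoneda (X : VCat V) (x : X.carrier) : X.presheaf.carrier :=
  ⟨fun y => X.hom y x, fun y z => X.comp_le y z x⟩

/-- `f ⊣ g` as `V`-functors. -/
def IsAdjunction (X Y : VCat V) (f : X.carrier → Y.carrier) (g : Y.carrier → X.carrier) : Prop :=
  IsVFunctor X Y f ∧ IsVFunctor Y X g ∧ ∀ x y, Y.hom (f x) y = X.hom x (g y)

/-- Constructively completely distributive (ccd) `V`-categories: the Yoneda embedding of `X`
has a left adjoint (`X` is cocomplete), which itself has a left adjoint. -/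
def IsCCD (X : VCat V) : Prop :=
  ∃ sup : X.presheaf.carrier → X.carrier, IsAdjunction X.presheaf X sup X.yoneda ∧
    ∃ t : X.carrier → X.presheaf.carrier, IsAdjunction X X.presheaf t sup

/-- `c` is a colimit of `h : A → X` weighted by the presheaf `p` on `A`. -/
def IsWeightedColimit {A X : VCat V} (p : A.presheaf.carrier) (h : A ⟶ X) (c : X.carrier) : Prop :=
  ∀ x, X.hom c x = ⨅ a, p.1 a ⇨ᵣ X.hom (h.toFun a) x

/-- `l` is a limit of `h : A → X` weighted by the copresheaf `q` on `A`. -/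
def IsWeightedLimit {A X : VCat V} (q : A.carrier → V) (h : A ⟶ X) (l : X.carrier) : Prop :=
  ∀ x, X.hom x l = ⨅ a, q a ⇨ᵣ X.hom x (h.toFun a)

/-- `f` preserves all weighted colimits that exist in `X`. -/
def PreservesWeightedColimits {X Y : VCat V} (f : X ⟶ Y) : Prop :=
  ∀ (A : VCat V) (p : A.presheaf.carrier) (h : A ⟶ X) (c : X.carrier),
    IsWeightedColimit p h c → IsWeightedColimit p (h ≫ f) (f.toFun c)

/-- `f` preserves all weighted limits that exist in `X`. -/
def PreservesWeightedLimits {X Y : VCat V} (f : X ⟶ Y) : Prop :=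
  ∀ (A : VCat V) (q : A.carrier → V), (∀ a b, q a * A.hom a b ≤ q b) →
    ∀ (h : A ⟶ X) (l : X.carrier), IsWeightedLimit q h l → IsWeightedLimit q (h ≫ f) (f.toFun l)

/-- The `V`-category `(V, hom)`. -/
def base (V : Type u) [CommMonoid V] [CompleteLattice V] [IsQuantale V] : VCat V where
  carrier := V
  hom := fun x y => x ⇨ᵣ y
  one_le := one_le_res
  comp_le := res_comp

/-- The power `V ^ X` of `(V, hom)`, for a set `X`. -/
def power (V : Type u) [CommMonoid V] [CompleteLattice V] [IsQuantale V] (X : Type u) :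
    VCat V where
  carrier := X → V
  hom s t := ⨅ x, (base V).hom (s x) (t x)
  one_le _ := le_iInf fun _ => one_le_res _
  comp_le _ _ _ := le_iInf fun x =>
    (mul_le_mul' (iInf_le _ x) (iInf_le _ x)).trans (res_comp _ _ _)

/-- The full sub-`V`-category on a set of objects. -/
def full (X : VCat V) (S : Set X.carrier) : VCat V where
  carrier := S
  hom s t := X.hom s.1 t.1
  one_le s := X.one_le s.1
  comp_le s t r := X.comp_le s.1 t.1 r.1

/-- The inclusion of a full sub-`V`-category. -/
def incl (X : VCat V) (S : Set X.carrier) : X.full S ⟶ X :=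
  ⟨fun s => s.1, fun _ _ => le_rfl⟩

end VCat

open VCat

/-- `S` is a subalgebra of the algebra `V ^ X` of the variety of ccd `V`-categories, whose
homomorphisms are the `V`-functors preserving weighted limits and weighted colimits: with the
structure induced from `V ^ X`, `S` is a ccd `V`-category, and its inclusion is a
homomorphism. -/
def IsCCDSubalgebra (X : Type u) (S : Set (X → V)) : Prop :=
  ((power V X).full S).IsCCD ∧
    PreservesWeightedColimits ((power V X).incl S) ∧ PreservesWeightedLimits ((power V X).incl S)

/-- Affine sets over the algebra `(V, hom)` of the variety of ccd `V`-categories. -/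
structure AfSet (V : Type u) [CommMonoid V] [CompleteLattice V] [IsQuantale V] where
  carrier : Type u
  fns : Set (carrier → V)
  isSubalgebra : IsCCDSubalgebra carrier fns

namespace AfSet

/-- Morphisms of affine sets: maps along which the distinguished functions pull back to
distinguished functions. -/
@[ext]
structure Hom (X Y : AfSet V) where
  toFun : X.carrier → Y.carrier
  comp_mem : ∀ φ ∈ Y.fns, φ ∘ toFun ∈ X.fns

instance : Category (AfSet V) where
  Hom := Hom
  id X := ⟨id, fun _ h => h⟩
  comp f g := ⟨g.toFun ∘ f.toFun, fun φ h => f.comp_mem _ (g.comp_mem φ h)⟩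

/-- Zariski closure: the intersection of all equalizers `Eq(φ, ψ)`, with `φ, ψ ∈ S`, that
contain `M`. -/
def zariskiClosure (X : AfSet V) (M : Set X.carrier) : Set X.carrier :=
  ⋂₀ {E | ∃ φ ∈ X.fns, ∃ ψ ∈ X.fns, E = {x | φ x = ψ x} ∧ M ⊆ E}

def IsZariskiClosed (X : AfSet V) (M : Set X.carrier) : Prop := X.zariskiClosure M = M

/-- The distinguished functions separate points. -/
def IsSeparated (X : AfSet V) : Prop :=
  ∀ x y : X.carrier, x ≠ y → ∃ φ ∈ X.fns, φ x ≠ φ y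

/-- Embeddings of affine sets: injective maps for which the domain carries the induced (initial)
structure. -/
def IsEmbedding {X Y : AfSet V} (i : X ⟶ Y) : Prop :=
  Function.Injective i.toFun ∧ X.fns = {s | ∃ φ ∈ Y.fns, s = φ ∘ i.toFun}

/-- Algebraic affine sets: separated, and Zariski-closed in every separated affine set. -/
def IsAlgebraic (X : AfSet V) : Prop :=
  X.IsSeparated ∧ ∀ (Y : AfSet V), Y.IsSeparated → ∀ i : X ⟶ Y, IsEmbedding i →
    Y.IsZariskiClosed (Set.range i.toFun)

end AfSet

theorem power_sep {X : Type u} {s t : X → V} (h : 1 ≤ (power V X).hom s t) : s ≤ t := fun x => by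
  have := h.trans (iInf_le _ x)
  simpa [base, le_res_iff] using this

theorem le_iInf_res {ι : Sort*} {f g : ι → V} {c : V} :
    c ≤ ⨅ i, f i ⇨ᵣ g i ↔ ∀ i, f i * c ≤ g i := by
  simp only [le_iInf_iff, le_res_iff]

theorem le_power_hom {X : Type u} {s t : X → V} {c : V} :
    c ≤ (power V X).hom s t ↔ ∀ x, s x * c ≤ t x := le_iInf_res

/-- A set of functions that is closed under the pointwise operations is a subalgebra. -/
theorem isCCDSubalgebra_of_closed (X : Type u) (S : Set (X → V))
    (hsup : ∀ (ι : Type u) (f : ι → X → V) (c : ι → V), (∀ i, f i ∈ S) →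
      (fun x => ⨆ i, c i * f i x) ∈ S)
    (hinf : ∀ (ι : Type u) (f : ι → X → V) (c : ι → V), (∀ i, f i ∈ S) →
      (fun x => ⨅ i, c i ⇨ᵣ f i x) ∈ S) :
    IsCCDSubalgebra X S := by
  let E := (power V X).full S
  have hE : ∀ {s t : E.carrier} {c : V}, c ≤ E.hom s t ↔ ∀ x, s.1 x * c ≤ t.1 x := le_power_hom
  let sup : E.presheaf.carrier → E.carrier := fun p =>
    ⟨fun x => ⨆ t : S, p.1 t * t.1 x, hsup S (fun t => t.1) p.1 (fun t => t.2)⟩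
  let m : X → E.carrier := fun x =>
    ⟨fun z => ⨅ t : S, t.1 x ⇨ᵣ t.1 z, hinf S (fun t => t.1) (fun t => t.1 x) (fun t => t.2)⟩
  have hm : ∀ x (s : E.carrier), E.hom (m x) s = s.1 x := by
    intro x s
    apply le_antisymm
    · have h := (hE (s := m x) (t := s)).1 le_rfl x
      refine le_trans ?_ h
      have h1 : (1 : V) ≤ (m x).1 x := le_iInf fun t => one_le_res _
      simpa using mul_le_mul_left h1 (E.hom (m x) s)
    · rw [hE]
      intro z
      have h1 : (m x).1 z ≤ s.1 x ⇨ᵣ s.1 z := iInf_le _ (s : S)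
      rw [mul_comm]
      exact (mul_le_mul_right h1 _).trans (mul_res_le _ _)
  have adjEq : ∀ {A B : VCat V} (f : A.carrier → B.carrier) (g : B.carrier → A.carrier),
      (∀ x y, B.hom (f x) y = A.hom x (g y)) → IsAdjunction A B f g := by
    intro A B f g h
    refine ⟨fun x x' => ?_, fun y y' => ?_, h⟩
    · rw [h]
      have h1 : 1 ≤ A.hom x' (g (f x')) := (h x' (f x')) ▸ B.one_le _
      have h2 := mul_le_mul_right h1 (A.hom x x')
      rw [mul_one] at h2
      exact h2.trans (A.comp_le _ _ _)
    · rw [← h]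
      have h1 : 1 ≤ B.hom (f (g y)) y := (h (g y) y).symm ▸ A.one_le _
      have h2 := mul_le_mul_left h1 (B.hom y y')
      rw [one_mul] at h2
      exact h2.trans (B.comp_le _ _ _)
  refine ⟨⟨sup, adjEq _ _ ?_, fun s => ⟨fun t => ⨆ x, s.1 x * E.hom t (m x), ?_⟩, adjEq _ _ ?_⟩,
    ?_, ?_⟩
  · intro p s
    refine eq_of_forall_le_iff fun c => ?_
    rw [show (p : E.presheaf.carrier) = p from rfl]
    change c ≤ E.hom (sup p) s ↔ c ≤ ⨅ t, p.1 t ⇨ᵣ E.hom t s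
    rw [hE, le_iInf_res]
    simp only [hE, sup, Quantale.iSup_mul_distrib, iSup_le_iff]
    constructor
    · intro h t x
      have := h x t
      rwa [mul_assoc, mul_left_comm] at this
    · intro h x t
      have := h t x
      rwa [mul_left_comm, ← mul_assoc] at this
  · intro t t'
    rw [Quantale.mul_iSup_distrib]
    refine iSup_mono fun x => ?_
    rw [mul_left_comm]
    exact mul_le_mul_right (E.comp_le _ _ _) _
  · intro s p
    refine eq_of_forall_le_iff fun c => ?_
    change c ≤ ⨅ t, (⨆ x, s.1 x * E.hom t (m x)) ⇨ᵣ p.1 t ↔ c ≤ E.hom s (sup p)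
    rw [hE, le_iInf_res]
    simp only [sup, Quantale.iSup_mul_distrib, iSup_le_iff]
    constructor
    · intro h x
      have h1 := h (m x) x
      have h2 := mul_le_mul_right (E.one_le (m x)) (s.1 x)
      rw [mul_one] at h2
      have h3 : s.1 x * c ≤ p.1 (m x) := (mul_le_mul_left h2 c).trans h1
      refine le_iSup_of_le (m x) (h3.trans ?_)
      have h4 : (1 : V) ≤ (m x).1 x := le_iInf fun t => one_le_res _
      simpa using mul_le_mul_right h4 (p.1 (m x))
    · intro h t x
      have h1 := h x
      have h2 : (⨆ t : S, p.1 t * t.1 x) ≤ p.1 (m x) := iSup_le fun r => by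
        rw [← hm x r, mul_comm]
        exact p.2 _ _
      calc s.1 x * E.hom t (m x) * c = E.hom t (m x) * (s.1 x * c) := by
            rw [mul_comm (s.1 x), mul_assoc]
        _ ≤ E.hom t (m x) * p.1 (m x) := mul_le_mul_right (h1.trans h2) _
        _ ≤ p.1 t := p.2 _ _
  · intro A p h c hc
    let l : E.carrier := ⟨fun x => ⨆ a, p.1 a * (h.toFun a).1 x,
      hsup A.carrier (fun a => (h.toFun a).1) p.1 (fun a => (h.toFun a).2)⟩
    have key : ∀ s : X → V, (power V X).hom l.1 s
        = ⨅ a, p.1 a ⇨ᵣ (power V X).hom (h.toFun a).1 s := by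
      intro s
      refine eq_of_forall_le_iff fun d => ?_
      rw [le_power_hom, le_iInf_res]
      simp only [Quantale.iSup_mul_distrib, iSup_le_iff]
      constructor
      · intro h' a
        refine le_power_hom.2 fun x => ?_
        have := h' x a
        rwa [mul_assoc, mul_left_comm] at this
      · intro h' x a
        have := le_power_hom.1 (h' a) x
        rwa [mul_left_comm, ← mul_assoc] at this
    have hcl : ∀ s : E.carrier, E.hom c s = E.hom l s := fun s => (hc s).trans (key s.1).symm
    have e : c.1 = l.1 := le_antisymm (α := X → V)
      (power_sep ((E.one_le l).trans (hcl l).ge)) (power_sep ((E.one_le c).trans (hcl c).le))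
    intro s
    change (power V X).hom c.1 s = _
    rw [e]
    exact key s
  · intro A q _ h c hc
    let l : E.carrier := ⟨fun x => ⨅ a, q a ⇨ᵣ (h.toFun a).1 x,
      hinf A.carrier (fun a => (h.toFun a).1) q (fun a => (h.toFun a).2)⟩
    have key : ∀ s : X → V, (power V X).hom s l.1
        = ⨅ a, q a ⇨ᵣ (power V X).hom s (h.toFun a).1 := by
      intro s
      refine eq_of_forall_le_iff fun d => ?_
      rw [le_power_hom, le_iInf_res]
      simp only [le_iInf_res]
      constructor
      · intro h' a
        refine le_power_hom.2 fun x => ?_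
        have := h' x a
        rwa [mul_left_comm] at this
      · intro h' x a
        have := le_power_hom.1 (h' a) x
        rwa [mul_left_comm] at this
    have hcl : ∀ s : E.carrier, E.hom s c = E.hom s l := fun s => (hc s).trans (key s.1).symm
    have e : c.1 = l.1 := le_antisymm (α := X → V)
      (power_sep ((E.one_le c).trans (hcl c).le)) (power_sep ((E.one_le l).trans (hcl l).ge))
    intro s
    change (power V X).hom s c.1 = _
    rw [e]
    exact key s

/-- The `V`-functors from `X` to `(V, hom)` form a subalgebra of `V ^ X`. -/
theorem isCCDSubalgebra_functors (X : VCat V) :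
    IsCCDSubalgebra X.carrier {φ : X.carrier → V | IsVFunctor X (base V) φ} := by
  have e : ∀ φ : X.carrier → V, IsVFunctor X (base V) φ ↔ ∀ x y, φ x * X.hom x y ≤ φ y :=
    fun φ => forall_congr' fun _ => forall_congr' fun _ => le_res_iff
  apply isCCDSubalgebra_of_closed
  · intro ι f c hf
    simp only [Set.mem_ofPred_eq, e] at hf ⊢
    intro x y
    rw [Quantale.iSup_mul_distrib]
    refine iSup_mono fun i => ?_
    rw [mul_assoc]
    exact mul_le_mul_right (hf i x y) _
  · intro ι f c hf
    simp only [Set.mem_ofPred_eq, e] at hf ⊢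
    intro x y
    rw [le_iInf_res]
    intro i
    rw [← mul_assoc]
    have h : c i * (⨅ j, c j ⇨ᵣ f j x) ≤ f i x := le_iInf_res.1 le_rfl i
    exact (mul_le_mul_left h _).trans (hf i x y)

/-- The functor sending a `V`-category `X` to the affine set of all `V`-functors from `X` to
`(V, hom)`, identical on morphisms. -/
def vcatToAfSet (V : Type u) [CommMonoid V] [CompleteLattice V] [IsQuantale V] :
    VCat V ⥤ AfSet V where
  obj X := ⟨X.carrier, {φ : X.carrier → V | IsVFunctor X (base V) φ}, isCCDSubalgebra_functors X⟩
  map f := ⟨f.toFun, fun _ h x x' => (f.isVFunctor x x').trans (h _ _)⟩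

/-- The functor sending an affine set `(X, S)` to the set `X` with the initial `V`-category
structure with respect to `S`, identical on morphisms. -/
def afSetToVCat (V : Type u) [CommMonoid V] [CompleteLattice V] [IsQuantale V] :
    AfSet V ⥤ VCat V where
  obj X :=
    { carrier := X.carrier
      hom := fun x y => ⨅ φ : X.fns, (base V).hom (φ.1 x) (φ.1 y)
      one_le := fun _ => le_iInf fun _ => one_le_res _
      comp_le := fun _ _ _ => le_iInf fun φ =>
        (mul_le_mul' (iInf_le _ φ) (iInf_le _ φ)).trans (res_comp _ _ _) }
  map {X Y} f := ⟨f.toFun, fun _ _ => le_iInf fun φ : Y.fns =>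
    iInf_le_of_le (⟨φ.1 ∘ f.toFun, f.comp_mem φ.1 φ.2⟩ : X.fns) le_rfl⟩

end

/-- A category is (equivalent to) a quasivariety over the category of sets if it is equivalent to
a regular epireflective full subcategory of a variety, that is, of a category that is monadic over
the category of sets. -/
def IsQuasivariety (Q : Type w) [Category.{v} Q] : Prop :=
  ∃ (A : Type (u + 1)) (_ : Category.{u} A) (G : A ⥤ Type u) (_ : MonadicRightAdjoint G)
    (P : ObjectProperty A) (_ : P.IsClosedUnderIsomorphisms) (_ : Reflective P.ι),
    (∀ X : A, IsRegularEpi ((reflectorAdjunction P.ι).unit.app X)) ∧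
      Nonempty (Q ≌ P.FullSubcategory)

open VCat

section

variable {V : Type u} [CommMonoid V] [CompleteLattice V] [IsQuantale V]

/-! A set of functions is a subalgebra of `V ^ X` exactly when it is closed under the pointwise
operations `⨆ i, c i * f i` and `⨅ i, c i ⇨ᵣ f i`. So if `a` is the initial structure of `(X, S)`,
each `a(x, -)`, being such a meet, lies in `S`, and so does every `V`-functor `φ = ⨆ x, φ x * a(x,
-)`: this is `mem_fns_iff` and gives one half of the isomorphism. The other half is the Yoneda
lemma.

For `V`-categories the Zariski closure of `M` is `{y | 1 ≤ ⨆ x ∈ M, X(y, x) * X(x, y)}`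
(`mem_closure_iff`). Since `V` is injective, embeddings out of a separated object are the fully
faithful functors. A point in the closure of a fully faithful image of `X` yields an adjoint pair on
`X`, so Cauchy completeness makes the image closed. Conversely, closedness under the Yoneda
embedding suffices, because a right adjoint distributor is a presheaf in the closure of the
representables.

For the quasivariety, `Hom(-, V)` on the dual category has the left adjoint `I ↦ V ^ I`. Regular
monos are the fully faithful functors. Hence the counit `X ⟶ V ^ Hom(X, V)` is a regular mono, and
injectivity of `V` turns regular epis of the dual into surjections. Under these conditions the
comparison functor to the algebras of the induced monad is fully faithful and has a left adjoint
with surjective unit (`isQuasivariety_of_adjunction`). -/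

theorem one_le_power_hom {X : Type u} {s t : X → V} : 1 ≤ (power V X).hom s t ↔ s ≤ t := by
  rw [le_power_hom]
  simp [Pi.le_def]

theorem mul_power_hom_le {X : Type u} (s t : X → V) (x : X) :
    s x * (power V X).hom s t ≤ t x :=
  le_power_hom.1 le_rfl x

/-! ### Subalgebras of powers are closed under the pointwise operations -/

namespace IsCCDSubalgebra

variable {X : Type u} {S : Set (X → V)}

/-- A subalgebra of a power of `V` is closed under pointwise weighted joins. -/
theorem iSup_mem (h : IsCCDSubalgebra X S) {ι : Type*} (f : ι → X → V) (c : ι → V)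
    (hf : ∀ i, f i ∈ S) : (fun x => ⨆ i, c i * f i x) ∈ S := by
  obtain ⟨⟨sup, hsup, -⟩, hcolim, -⟩ := h
  let E := (power V X).full S
  let g : ι → E.carrier := fun i => ⟨f i, hf i⟩
  -- The presheaf generated by the weights `c i` at the `f i`. Its colimit in `S` is `sup p`; since
  -- the inclusion preserves it, `sup p` has in `V ^ X` the universal property of the pointwise
  -- join.
  let p : E.presheaf.carrier := ⟨fun t => ⨆ i, E.hom t (g i) * c i, fun s t => by
    rw [Quantale.mul_iSup_distrib]
    refine iSup_mono fun i => ?_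
    rw [← mul_assoc]
    exact mul_le_mul_left (E.comp_le _ _ _) _⟩
  have key : ∀ s : X → V,
      (power V X).hom (sup p).1 s = ⨅ t : E.carrier, p.1 t ⇨ᵣ (power V X).hom t.1 s :=
    hcolim E p (𝟙 E) (sup p) fun s => hsup.2.2 p s
  have e : (fun x => ⨆ i, c i * f i x) = (sup p).1 := by
    refine le_antisymm (α := X → V) (fun x => iSup_le fun i => ?_) ?_
    · have h1 := (key (sup p).1).le
      rw [le_iInf_res] at h1
      have h2 : c i ≤ (power V X).hom (f i) (sup p).1 := by
        calc c i ≤ p.1 (g i) := le_iSup_of_le i (by simpa using mul_le_mul_left (E.one_le (g i)) (c i))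
          _ ≤ p.1 (g i) * (power V X).hom (sup p).1 (sup p).1 := by
            simpa using mul_le_mul_right ((power V X).one_le (sup p).1) (p.1 (g i))
          _ ≤ _ := h1 (g i)
      rw [mul_comm]
      exact le_power_hom.1 h2 x
    · refine one_le_power_hom.1 (le_of_le_of_eq ?_ (key _).symm)
      rw [le_iInf_res]
      intro t
      rw [mul_one]
      refine iSup_le fun i => le_power_hom.2 fun x => ?_
      rw [← mul_assoc]
      refine le_iSup_of_le (f := fun i => c i * f i x) i ?_
      rw [mul_comm]
      exact mul_le_mul_right (mul_power_hom_le _ _ x) _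
  rw [e]
  exact (sup p).2

/-- A subalgebra of a power of `V` is closed under pointwise weighted meets. -/
theorem iInf_mem (h : IsCCDSubalgebra X S) {ι : Type*} (f : ι → X → V) (c : ι → V)
    (hf : ∀ i, f i ∈ S) : (fun x => ⨅ i, c i ⇨ᵣ f i x) ∈ S := by
  obtain ⟨⟨sup, hsup, -⟩, -, hlim⟩ := h
  let E := (power V X).full S
  let g : ι → E.carrier := fun i => ⟨f i, hf i⟩
  let q : E.carrier → V := fun t => ⨆ i, c i * E.hom (g i) t
  have hq : ∀ s t, q s * E.hom s t ≤ q t := fun s t => by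
    rw [Quantale.iSup_mul_distrib]
    refine iSup_mono fun i => ?_
    rw [mul_assoc]
    exact mul_le_mul_right (E.comp_le _ _ _) _
  -- The presheaf of `q`-weighted lower bounds: its supremum is the `q`-weighted limit, so
  -- cocompleteness of `S` supplies limits as well.
  let p : E.presheaf.carrier := ⟨fun s => ⨅ t, q t ⇨ᵣ E.hom s t, fun r s => by
    rw [le_iInf_res]
    intro t
    rw [mul_left_comm]
    exact (mul_le_mul_right (le_iInf_res.1 le_rfl t) _).trans (E.comp_le _ _ _)⟩
  have hs : ∀ s, E.hom (sup p) s = ⨅ t, p.1 t ⇨ᵣ E.hom t s := fun s => hsup.2.2 p s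
  have hl : IsWeightedLimit q (𝟙 E) (sup p) := by
    intro x
    apply le_antisymm
    · rw [le_iInf_res]
      intro t
      rw [mul_comm]
      refine (mul_le_mul_right ?_ _).trans (E.comp_le x (sup p) t)
      rw [hs, le_iInf_res]
      intro s
      rw [mul_comm]
      exact le_iInf_res.1 le_rfl t
    · have h1 := (E.one_le (sup p)).trans (hs (sup p)).le
      rw [le_iInf_res] at h1
      simpa using! h1 x
  have key : ∀ s : X → V,
      (power V X).hom s (sup p).1 = ⨅ t : E.carrier, q t ⇨ᵣ (power V X).hom s t.1 :=
    hlim E q hq (𝟙 E) (sup p) hl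
  have e : (fun x => ⨅ i, c i ⇨ᵣ f i x) = (sup p).1 := by
    refine le_antisymm (α := X → V) ?_ (fun x => le_iInf_res.2 fun i => ?_)
    · refine one_le_power_hom.1 (le_of_le_of_eq ?_ (key _).symm)
      rw [le_iInf_res]
      intro t
      rw [mul_one]
      refine iSup_le fun i => le_power_hom.2 fun x => ?_
      rw [← mul_assoc]
      refine le_trans (mul_le_mul_left ?_ _) (mul_power_hom_le (f i) t.1 x)
      rw [mul_comm]
      exact le_iInf_res.1 le_rfl i
    · have h1 := ((power V X).one_le (sup p).1).trans (key (sup p).1).le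
      rw [le_iInf_res] at h1
      have h2 : c i ≤ (power V X).hom (sup p).1 (f i) := by
        calc c i ≤ q (g i) := le_iSup_of_le i (by simpa using mul_le_mul_right (E.one_le (g i)) (c i))
          _ ≤ _ := by simpa using! h1 (g i)
      rw [mul_comm]
      exact le_power_hom.1 h2 x
  rw [e]
  exact (sup p).2

end IsCCDSubalgebra

/-! ### Zariski closure and embeddings in terms of `V`-categories -/

namespace VCat

theorem isVFunctor_base_iff {X : VCat V} {φ : X.carrier → V} :
    IsVFunctor X (base V) φ ↔ ∀ x y, φ x * X.hom x y ≤ φ y :=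
  forall_congr' fun _ => forall_congr' fun _ => le_res_iff

theorem isVFunctor_hom (X : VCat V) (x : X.carrier) : IsVFunctor X (base V) (X.hom x) :=
  isVFunctor_base_iff.2 fun _ _ => X.comp_le _ _ _

theorem iSup_mul' {ι : Sort*} (f : ι → V) (a : V) : (⨆ i, f i) * a = ⨆ i, f i * a := by
  refine eq_of_forall_ge_iff fun c => ?_
  rw [mul_comm, ← le_res_iff, iSup_le_iff, iSup_le_iff]
  exact forall_congr' fun i => by rw [le_res_iff, mul_comm]

/-- The weighted join of corepresentable functors. -/
theorem isVFunctor_iSup (X : VCat V) {ι : Sort*} (c : ι → V) (x : ι → X.carrier) :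
    IsVFunctor X (base V) (fun y => ⨆ i, c i * X.hom (x i) y : X.carrier → V) :=
  isVFunctor_base_iff.2 fun y z => by
    rw [iSup_mul']
    refine iSup_mono fun i => ?_
    rw [mul_assoc]
    exact mul_le_mul_right (X.comp_le _ _ _) _

theorem le_mul_of_one_le {a b : V} (h : 1 ≤ b) : a ≤ a * b := by
  simpa using mul_le_mul_right h a

theorem le_mul_of_one_le' {a b : V} (h : 1 ≤ b) : a ≤ b * a := by
  simpa using mul_le_mul_left h a

/-- `y` belongs to the closure of `M` if `y` is represented by an adjunction of distributors that
factors through `M`. -/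
def closure (X : VCat V) (M : Set X.carrier) : Set X.carrier :=
  {y | 1 ≤ ⨆ x : M, X.hom y x * X.hom x y}

/-- `φ y ≤ ⨆ x, φ y * X(y, x) * X(x, y) ≤ ⨆ x, φ x * X(x, y) = ⨆ x, ψ x * X(x, y) ≤ ψ y`, with `x`
ranging over `M`, and symmetrically. -/
theorem eq_of_mem_closure {X : VCat V} {M : Set X.carrier} {y : X.carrier} (hy : y ∈ X.closure M)
    {φ ψ : X.carrier → V} (hφ : IsVFunctor X (base V) φ) (hψ : IsVFunctor X (base V) ψ)
    (h : ∀ x ∈ M, φ x = ψ x) : φ y = ψ y := by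
  have key : ∀ {φ ψ : X.carrier → V}, IsVFunctor X (base V) φ → IsVFunctor X (base V) ψ →
      (∀ x ∈ M, φ x = ψ x) → φ y ≤ ψ y := by
    intro φ ψ hφ hψ h
    rw [isVFunctor_base_iff] at hφ hψ
    refine (le_mul_of_one_le hy).trans ?_
    rw [Quantale.mul_iSup_distrib]
    refine iSup_le fun x => ?_
    rw [← mul_assoc]
    refine (mul_le_mul_left (hφ y x) _).trans ?_
    rw [h x x.2]
    exact hψ _ _
  exact le_antisymm (key hφ hψ h) (key hψ hφ fun x hx => (h x hx).symm)

theorem mem_closure_iff {X : VCat V} {M : Set X.carrier} {y : X.carrier} :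
    y ∈ X.closure M ↔ ∀ φ ψ : X.carrier → V, IsVFunctor X (base V) φ →
      IsVFunctor X (base V) ψ → (∀ x ∈ M, φ x = ψ x) → φ y = ψ y := by
  refine ⟨fun hy φ ψ hφ hψ h => eq_of_mem_closure hy hφ hψ h, fun h => ?_⟩
  -- The universal test pair: `X(y, -)` and its best approximation through `M` agree on `M`;
  -- equality at `y` is the closure condition.
  have h1 := h (X.hom y) (fun z => ⨆ x : M, X.hom y x * X.hom x z) (X.isVFunctor_hom y)
    (X.isVFunctor_iSup _ _) fun x hx => le_antisymm
      (le_iSup_of_le (f := fun x' : M => X.hom y x' * X.hom x' x) ⟨x, hx⟩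
        (le_mul_of_one_le (X.one_le x)))
      (iSup_le fun _ => X.comp_le _ _ _)
  exact (X.one_le y).trans h1.le

theorem subset_closure (X : VCat V) (M : Set X.carrier) : M ⊆ X.closure M := fun x hx =>
  mem_closure_iff.2 fun _ _ _ _ h => h x hx

theorem zariskiClosure_obj (X : VCat V) (M : Set X.carrier) :
    ((vcatToAfSet V).obj X).zariskiClosure M = X.closure M := by
  refine Set.ext fun y => Iff.trans ?_ mem_closure_iff.symm
  simp only [AfSet.zariskiClosure, Set.mem_sInter]
  constructor
  · intro h φ ψ hφ hψ hM
    exact h {x | φ x = ψ x} ⟨φ, hφ, ψ, hψ, rfl, hM⟩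
  · rintro h E ⟨φ, hφ, ψ, hψ, rfl, hM⟩
    exact h φ ψ hφ hψ hM

/-- A `V`-functor is fully faithful if it preserves the hom-objects strictly. -/
def IsFullyFaithful {X Y : VCat V} (f : X ⟶ Y) : Prop :=
  ∀ x x', Y.hom (f.toFun x) (f.toFun x') = X.hom x x'

theorem IsFullyFaithful.injective {X Y : VCat V} {f : X ⟶ Y} (hf : IsFullyFaithful f)
    (hX : X.IsSeparated) : Function.Injective f.toFun := fun x x' h =>
  hX x x' (by rw [← hf, h]; exact Y.one_le _) (by rw [← hf, h]; exact Y.one_le _)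

/-- The quantale `V` is injective with respect to fully faithful functors. -/
theorem IsFullyFaithful.exists_extension {X Y : VCat V} {f : X ⟶ Y} (hf : IsFullyFaithful f)
    {φ : X.carrier → V} (hφ : IsVFunctor X (base V) φ) :
    ∃ ψ : Y.carrier → V, IsVFunctor Y (base V) ψ ∧ φ = ψ ∘ f.toFun := by
  -- The left Kan extension of `φ` along `f`.
  refine ⟨fun y => ⨆ x, φ x * Y.hom (f.toFun x) y, isVFunctor_iSup _ _ _, funext fun x => ?_⟩
  apply le_antisymm
  · exact le_iSup_of_le (f := fun x' => φ x' * Y.hom (f.toFun x') (f.toFun x)) x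
      (le_mul_of_one_le (Y.one_le _))
  · refine iSup_le fun x' => ?_
    rw [hf]
    exact isVFunctor_base_iff.1 hφ _ _

/-- If `X(x, -)` extends along `f` to `ψ`, then `1 ≤ ψ (f x)`, so `Y(f x, f x') ≤ ψ (f x') = X(x,
x')`. The converse is injectivity of `V`. -/
theorem isEmbedding_map_iff {X Y : VCat V} (f : X ⟶ Y) (hX : X.IsSeparated) :
    AfSet.IsEmbedding ((vcatToAfSet V).map f) ↔ IsFullyFaithful f := by
  constructor
  · rintro ⟨-, h⟩ x x'
    refine le_antisymm ?_ (f.isVFunctor x x')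
    have h1 : X.hom x ∈ ((vcatToAfSet V).obj X).fns := X.isVFunctor_hom x
    rw [h] at h1
    obtain ⟨ψ, hψ, e⟩ := h1
    have h2 := isVFunctor_base_iff.1 hψ (f.toFun x) (f.toFun x')
    have e' : ∀ z, X.hom x z = ψ (f.toFun z) := fun z => congrFun e z
    rw [← e', ← e'] at h2
    exact (le_mul_of_one_le' (X.one_le x)).trans h2
  · intro h
    refine ⟨h.injective hX, Set.ext fun φ => ⟨fun hφ => h.exists_extension hφ, ?_⟩⟩
    rintro ⟨ψ, hψ, rfl⟩
    exact ((vcatToAfSet V).map f).comp_mem ψ hψ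

/-! ### Adjoint pairs and Cauchy completeness -/

/-- The data of an adjunction between distributors from and to the unit `V`-category. -/
structure IsAdjointPair (X : VCat V) (φ ψ : X.carrier → V) : Prop where
  map_left : ∀ x y, φ x * X.hom x y ≤ φ y
  map_right : ∀ x y, X.hom x y * ψ y ≤ ψ x
  unit : 1 ≤ ⨆ x, φ x * ψ x
  counit : ∀ x y, ψ x * φ y ≤ X.hom x y

theorem IsDistAdjunction.isAdjointPair {Y X : VCat V} {φ : Y.carrier → X.carrier → V}
    {ψ : X.carrier → Y.carrier → V} (h : IsDistAdjunction Y X φ ψ) (y : Y.carrier) :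
    IsAdjointPair X (φ y) (fun x => ψ x y) where
  map_left := h.1.2 y
  map_right x x' := h.2.1.1 x x' y
  unit := (Y.one_le y).trans (h.2.2.1 y y)
  counit x x' := (le_iSup (fun y => ψ x y * φ y x') y).trans (h.2.2.2 x x')

theorem IsAdjointPair.right_eq {X : VCat V} {φ ψ : X.carrier → V} (h : IsAdjointPair X φ ψ)
    {x : X.carrier} (hx : φ = X.hom x) (y : X.carrier) : ψ y = X.hom y x := by
  subst hx
  have h1 : 1 ≤ ψ x := h.unit.trans (iSup_le fun z => h.map_right x z)
  exact le_antisymm ((le_mul_of_one_le (X.one_le x)).trans (h.counit y x))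
    ((le_mul_of_one_le h1).trans (h.map_right y x))

theorem IsAdjointPair.left_eq {X : VCat V} {φ ψ : X.carrier → V} (h : IsAdjointPair X φ ψ)
    {x : X.carrier} (hx : ∀ y, ψ y = X.hom y x) : φ = X.hom x := by
  obtain rfl : ψ = fun y => X.hom y x := funext hx
  have h1 : 1 ≤ φ x := h.unit.trans (iSup_le fun z => h.map_left z x)
  exact funext fun y => le_antisymm ((le_mul_of_one_le' (X.one_le x)).trans (h.counit x y))
    ((le_mul_of_one_le' h1).trans (h.map_left x y))

/-- The unit `V`-category. -/
def unitVCat (V : Type u) [CommMonoid V] [CompleteLattice V] [IsQuantale V] : VCat V where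
  carrier := PUnit
  hom _ _ := 1
  one_le _ := le_rfl
  comp_le _ _ _ := (mul_one _).le

/-- Adjunctions of distributors restrict to each point of `Y`, and the representing points chosen
separately form a `V`-functor because of the unit inequality. -/
theorem isCauchyComplete_iff {X : VCat V} :
    X.IsCauchyComplete ↔ ∀ φ ψ : X.carrier → V, IsAdjointPair X φ ψ → ∃ x, φ = X.hom x := by
  constructor
  · intro hX φ ψ h
    obtain ⟨f, hf, -⟩ := hX (unitVCat V) (fun _ => φ) (fun x _ => ψ x)
      ⟨⟨fun _ _ _ => (one_mul _).le, fun _ => h.map_left⟩,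
        ⟨fun x x' _ => h.map_right x x', fun _ _ _ => (mul_one _).le⟩,
        fun _ _ => h.unit, fun x x' => iSup_le fun _ => h.counit x x'⟩
    exact ⟨f.toFun PUnit.unit, funext (hf PUnit.unit)⟩
  · intro hX Y φ ψ h
    choose f hf using fun y => hX _ _ (h.isAdjointPair y)
    have hf' : ∀ x y, ψ x y = X.hom x (f y) := fun x y => (h.isAdjointPair y).right_eq (hf y) x
    refine ⟨⟨f, fun y y' => (h.2.2.1 y y').trans (iSup_le fun x => ?_)⟩,
      fun y x => congrFun (hf y) x, hf'⟩
    rw [hf, hf']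
    exact X.comp_le _ _ _

theorem isSeparated_presheaf (X : VCat V) : X.presheaf.IsSeparated := by
  have key : ∀ p q : X.presheaf.carrier, 1 ≤ X.presheaf.hom p q → p.1 ≤ q.1 := fun p q h x => by
    simpa using! le_iInf_res.1 h x
  exact fun p q h h' => Subtype.ext (le_antisymm (key p q h) (key q p h'))

theorem presheaf_hom_yoneda (X : VCat V) (x : X.carrier) (p : X.presheaf.carrier) :
    X.presheaf.hom (X.yoneda x) p = p.1 x := by
  apply le_antisymm
  · have h := le_iInf_res.1 (le_refl (X.presheaf.hom (X.yoneda x) p)) x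
    exact (le_mul_of_one_le' (X.one_le x)).trans h
  · exact le_iInf_res.2 fun y => p.2 y x

/-- The Yoneda embedding as a morphism. -/
def yonedaHom (X : VCat V) : X ⟶ X.presheaf :=
  ⟨X.yoneda, fun x y => (X.presheaf_hom_yoneda x (X.yoneda y)).ge⟩

theorem isFullyFaithful_yonedaHom (X : VCat V) : IsFullyFaithful X.yonedaHom := fun x y =>
  X.presheaf_hom_yoneda x (X.yoneda y)

/-- Separated Cauchy complete `V`-categories are closed in each `V`-category. -/
theorem IsCauchyComplete.closure_range_subset {X Y : VCat V} (hX : X.IsCauchyComplete)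
    (hY : Y.IsSeparated) {f : X ⟶ Y} (hf : IsFullyFaithful f) :
    Y.closure (Set.range f.toFun) ⊆ Set.range f.toFun := by
  intro y hy
  -- The closure condition at `y` is precisely the unit of this pair; the other axioms are
  -- composition in `Y`.
  have h : IsAdjointPair X (fun x => Y.hom y (f.toFun x)) (fun x => Y.hom (f.toFun x) y) :=
    { map_left := fun x x' => by rw [← hf]; exact Y.comp_le _ _ _
      map_right := fun x x' => by rw [← hf]; exact Y.comp_le _ _ _
      unit := hy.trans (iSup_le fun z => by
        obtain ⟨_, x, rfl⟩ := z
        exact le_iSup (fun x => Y.hom y (f.toFun x) * Y.hom (f.toFun x) y) x)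
      counit := fun x x' => by rw [← hf]; exact Y.comp_le _ _ _ }
  obtain ⟨x, hx⟩ := isCauchyComplete_iff.1 hX _ _ h
  refine ⟨x, hY _ _ ?_ ?_⟩
  · exact (h.right_eq hx x).symm ▸ X.one_le x
  · exact (congrFun hx x).symm ▸ X.one_le x

/-- View the right adjoint `ψ` as a presheaf `p`. The counit gives `φ x ≤ hom p (yoneda x)` and
Yoneda gives `ψ x = hom (yoneda x) p`, so the unit places `p` in the closure of the representables.
-/
theorem isCauchyComplete_of_closure_subset {X : VCat V}
    (h : X.presheaf.closure (Set.range X.yoneda) ⊆ Set.range X.yoneda) : X.IsCauchyComplete := by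
  refine isCauchyComplete_iff.2 fun φ ψ hφψ => ?_
  let p : X.presheaf.carrier := ⟨ψ, hφψ.map_right⟩
  have hp : p ∈ X.presheaf.closure (Set.range X.yoneda) := by
    refine hφψ.unit.trans (iSup_le fun x => ?_)
    refine le_iSup_of_le (f := fun q : Set.range X.yoneda =>
      X.presheaf.hom p q * X.presheaf.hom q p) ⟨X.yoneda x, x, rfl⟩ (mul_le_mul' ?_ ?_)
    · exact le_iInf_res.2 fun y => hφψ.counit y x
    · exact (X.presheaf_hom_yoneda x p).ge
  obtain ⟨x, hx⟩ := h hp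
  exact ⟨x, hφψ.left_eq fun y => (congrFun (congrArg Subtype.val hx) y).symm⟩

theorem isSeparated_obj_iff (X : VCat V) :
    ((vcatToAfSet V).obj X).IsSeparated ↔ X.IsSeparated := by
  constructor
  · intro h x y hxy hyx
    by_contra hne
    obtain ⟨φ, hφ, hne⟩ := h x y hne
    have hφ := isVFunctor_base_iff.1 hφ
    exact hne (le_antisymm ((le_mul_of_one_le hxy).trans (hφ x y))
      ((le_mul_of_one_le hyx).trans (hφ y x)))
  · intro h x y hne
    by_contra! hc
    have h1 := hc _ (X.isVFunctor_hom x)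
    have h2 := hc _ (X.isVFunctor_hom y)
    exact hne (h x y ((X.one_le x).trans h1.le) ((X.one_le y).trans h2.ge))

end VCat

/-! ### The isomorphism of categories and algebraic affine sets -/

theorem vcatToAfSet_comp_afSetToVCat : vcatToAfSet V ⋙ afSetToVCat V = 𝟭 (VCat V) := by
  have e : ∀ X : VCat V, ((vcatToAfSet V ⋙ afSetToVCat V).obj X).hom = X.hom := fun X => by
    funext x y
    apply le_antisymm
    · refine (le_mul_of_one_le' (X.one_le x)).trans ?_
      exact le_res_iff.1 (iInf_le (fun φ : ((vcatToAfSet V).obj X).fns =>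
        (base V).hom (φ.1 x) (φ.1 y)) ⟨X.hom x, X.isVFunctor_hom x⟩)
    · exact le_iInf fun φ => φ.2 x y
  -- With the hom abstracted, the equality can be eliminated; the transport maps are then seen to be
  -- the identity on points, as needed to compare morphisms.
  have key : ∀ (X : VCat V) (h : X.carrier → X.carrier → V) (h₁ h₂) (e : h = X.hom),
      ∃ e' : VCat.mk X.carrier h h₁ h₂ = X, (eqToHom e').toFun = id ∧
        (eqToHom e'.symm).toFun = id := by
    rintro X h h₁ h₂ rfl
    exact ⟨rfl, rfl, rfl⟩
  have key' := fun X : VCat V => key X _ ((vcatToAfSet V ⋙ afSetToVCat V).obj X).one_le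
    ((vcatToAfSet V ⋙ afSetToVCat V).obj X).comp_le (e X)
  refine CategoryTheory.Functor.ext (fun X => (key' X).1) fun X Y f => ?_
  apply VCat.Hom.ext
  have h1 := (key' X).2.1
  have h2 := (key' Y).2.2
  refine Eq.trans ?_ (congrArg₂ (fun p q => q ∘ f.toFun ∘ p) h1 h2).symm
  rfl

theorem mem_fns_iff (X : AfSet V) (φ : X.carrier → V) :
    IsVFunctor ((afSetToVCat V).obj X) (base V) φ ↔ φ ∈ X.fns := by
  constructor
  · intro h
    replace h := (isVFunctor_base_iff (X := (afSetToVCat V).obj X) (φ := φ)).1 h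
    let a := ((afSetToVCat V).obj X).hom
    have e : φ = fun y => ⨆ x, φ x * a x y := funext fun y => le_antisymm
      (le_iSup_of_le (f := fun x => φ x * a x y) y
        (le_mul_of_one_le (((afSetToVCat V).obj X).one_le y)))
      (iSup_le fun x => h x y)
    rw [e]
    exact X.isSubalgebra.iSup_mem a φ fun x =>
      X.isSubalgebra.iInf_mem (fun t : X.fns => t.1) (fun t => t.1 x) fun t => t.2
  · exact fun h x y => iInf_le (fun φ : X.fns => (base V).hom (φ.1 x) (φ.1 y)) ⟨φ, h⟩

theorem afSetToVCat_comp_vcatToAfSet : afSetToVCat V ⋙ vcatToAfSet V = 𝟭 (AfSet V) := by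
  have key : ∀ (X : AfSet V) (S : Set (X.carrier → V)) (h) (e : S = X.fns),
      ∃ e' : AfSet.mk X.carrier S h = X, (eqToHom e').toFun = id ∧
        (eqToHom e'.symm).toFun = id := by
    rintro X S h rfl
    exact ⟨rfl, rfl, rfl⟩
  have key' := fun X : AfSet V => key X _ (isCCDSubalgebra_functors ((afSetToVCat V).obj X))
    (Set.ext (mem_fns_iff X))
  refine CategoryTheory.Functor.ext (fun X => (key' X).1) fun X Y f => ?_
  apply AfSet.Hom.ext
  have h1 := (key' X).2.1
  have h2 := (key' Y).2.2
  refine Eq.trans ?_ (congrArg₂ (fun p q => q ∘ f.toFun ∘ p) h1 h2).symm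
  rfl

/-- The Yoneda embedding is the test embedding for one direction; for the other, every affine set
and every morphism comes from `V`-categories. -/
theorem isAlgebraic_obj_iff (X : VCat V) :
    ((vcatToAfSet V).obj X).IsAlgebraic ↔ X.IsSeparated ∧ X.IsCauchyComplete := by
  rw [AfSet.IsAlgebraic, isSeparated_obj_iff]
  refine and_congr_right fun hX => ⟨fun h => ?_, fun h Y hY i hi => ?_⟩
  · have h1 := h ((vcatToAfSet V).obj X.presheaf)
      ((isSeparated_obj_iff _).2 X.isSeparated_presheaf) ((vcatToAfSet V).map X.yonedaHom)
      ((isEmbedding_map_iff _ hX).2 X.isFullyFaithful_yonedaHom)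
    exact isCauchyComplete_of_closure_subset
      ((zariskiClosure_obj X.presheaf _).symm.trans h1).subset
  · obtain ⟨Y, rfl⟩ : ∃ Y', (vcatToAfSet V).obj Y' = Y :=
      ⟨_, Functor.congr_obj afSetToVCat_comp_vcatToAfSet Y⟩
    obtain ⟨f, rfl⟩ : ∃ f : X ⟶ Y, (vcatToAfSet V).map f = i := by
      refine ⟨⟨i.toFun, fun x x' => ?_⟩, rfl⟩
      have := isVFunctor_base_iff.1 (i.comp_mem _ (Y.isVFunctor_hom (i.toFun x))) x x'
      exact (le_mul_of_one_le' (Y.one_le _)).trans this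
    rw [isEmbedding_map_iff _ hX] at hi
    refine (zariskiClosure_obj Y _).trans ?_
    exact (h.closure_range_subset ((isSeparated_obj_iff Y).1 hY) hi).antisymm
      (Y.subset_closure _)

theorem isAlgebraic_iff (X : AfSet V) : X.IsAlgebraic ↔
    ((afSetToVCat V).obj X).IsSeparated ∧ ((afSetToVCat V).obj X).IsCauchyComplete := by
  rw [← isAlgebraic_obj_iff]
  exact (congrArg AfSet.IsAlgebraic (Functor.congr_obj afSetToVCat_comp_vcatToAfSet X)).symm.to_iff

end

/-! ### A criterion for quasivarieties over sets -/

section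

open Limits Monad

/-- Surjective homomorphisms of algebras of a monad on the category of sets are regular epis. -/
theorem isRegularEpi_of_surjective {T : Monad (Type u)} {A B : T.Algebra} (f : A ⟶ B)
    (hf : Function.Surjective f.f) : IsRegularEpi f := by
  let R : Type u := {p : A.A × A.A // f.f p.1 = f.f p.2}
  let l : R ⟶ T.forget.obj A := TypeCat.ofHom fun p => p.1.1
  let r : R ⟶ T.forget.obj A := TypeCat.ofHom fun p => p.1.2
  have hlr : l ≫ f.f = r ≫ f.f := by
    ext p
    exact p.2
  let s : T.forget.obj B ⟶ T.forget.obj A := TypeCat.ofHom (Function.surjInv hf)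
  have hs : s ≫ f.f = 𝟙 _ := by
    ext b
    exact Function.surjInv_eq hf b
  have hfs : IsSplitEpi f.f := ⟨⟨⟨s, hs⟩⟩⟩
  have hepi : Epi (T.map f.f) := inferInstance
  have hepi' : Epi f.f := inferInstance
  have hw : (T.adj.homEquiv R A).symm l ≫ f = (T.adj.homEquiv R A).symm r ≫ f := by
    rw [← Adjunction.homEquiv_naturality_right_symm, ← Adjunction.homEquiv_naturality_right_symm]
    exact congrArg _ hlr
  -- `f` is the coequalizer of the two maps from the free algebra on its kernel pair `R`. A cofork
  -- descends on underlying sets through the section `s`; the result is a homomorphism since `T.map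
  -- f.f` is epi.
  refine ⟨⟨⟨T.free.obj R, _, _, hw, Cofork.IsColimit.mk' _ fun c => ?_⟩⟩⟩
  have hc : l ≫ c.π.f = r ≫ c.π.f := by
    have h1 := c.condition
    apply_fun T.adj.homEquiv R _ at h1
    rw [Adjunction.homEquiv_naturality_right, Adjunction.homEquiv_naturality_right,
      Equiv.apply_symm_apply, Equiv.apply_symm_apply] at h1
    exact h1
  have hfac : f.f ≫ s ≫ c.π.f = c.π.f := by
    ext a
    have h1 : f.f (s (f.f a)) = f.f a := Function.surjInv_eq hf (f.f a)
    exact ConcreteCategory.congr_hom hc ⟨(s (f.f a), a), h1⟩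
  refine ⟨⟨s ≫ c.π.f, ?_⟩, ?_, ?_⟩
  · rw [← cancel_epi (T.map f.f), ← T.map_comp_assoc, hfac, c.π.h]
    have h2 := f.h
    have h3 : T.map f.f ≫ B.a ≫ s ≫ c.π.f = A.a ≫ f.f ≫ s ≫ c.π.f := by
      rw [← Category.assoc, h2, Category.assoc]
    rw [hfac] at h3
    exact h3.symm
  · ext1
    exact hfac
  · intro m hm
    ext1
    rw [← cancel_epi f.f]
    exact (congrArg Monad.Algebra.Hom.f hm).trans hfac.symm

section

variable {C D : Type*} [Category* C] [Category* D] (i : C ⥤ D) [Reflective i]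

/-- The universal property of the reflection, for the essential image of a reflective functor. -/
noncomputable def essImageHomEquiv (X : D) (Y : i.EssImageSubcategory) :
    (i.toEssImage.obj ((reflector i).obj X) ⟶ Y) ≃ (X ⟶ i.essImage.ι.obj Y) :=
  i.essImage.fullyFaithfulι.homEquiv.trans (unitCompPartialBijective X Y.property).symm

theorem essImageHomEquiv_apply (X : D) (Y : i.EssImageSubcategory)
    (f : i.toEssImage.obj ((reflector i).obj X) ⟶ Y) :
    essImageHomEquiv i X Y f = (reflectorAdjunction i).unit.app X ≫ i.essImage.ι.map f :=
  unitCompPartialBijective_symm_apply _ _ _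

theorem essImageHomEquiv_comp (X : D) (Y Y' : i.EssImageSubcategory) (g : Y ⟶ Y')
    (f : i.toEssImage.obj ((reflector i).obj X) ⟶ Y) :
    essImageHomEquiv i X Y' (f ≫ g) = essImageHomEquiv i X Y f ≫ i.essImage.ι.map g := by
  rw [essImageHomEquiv_apply, essImageHomEquiv_apply, Functor.map_comp]
  exact (Category.assoc _ _ _).symm

/-- The essential image of a reflective functor is a reflective subcategory. -/
noncomputable abbrev reflectiveEssImage : Reflective i.essImage.ι where
  L := _
  adj := Adjunction.adjunctionOfEquivLeft (essImageHomEquiv i) (essImageHomEquiv_comp i)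

theorem reflectiveEssImage_unit_app (X : D) :
    letI := reflectiveEssImage i
    (reflectorAdjunction i.essImage.ι).unit.app X = (reflectorAdjunction i).unit.app X :=
  (essImageHomEquiv_apply i X _ (𝟙 _)).trans (Category.comp_id _)

end

variable {C : Type w} [Category.{u} C] {F : Type u ⥤ C} {U : C ⥤ Type u}

/-- If the components of the counit are regular epis, then they are the coequalizers of their
canonical pairs. -/
theorem nonempty_isColimit_counitCofork (adj : F ⊣ U)
    (hε : ∀ B, IsRegularEpi (adj.counit.app B)) (B : C) :
    Nonempty (IsColimit (MonadicityInternal.counitCofork adj B)) := by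
  obtain ⟨⟨r⟩⟩ := hε B
  have hepi : Epi (adj.counit.app r.W) := (hε r.W).getStruct.epi
  refine ⟨Cofork.IsColimit.mk' _ fun c => ?_⟩
  have hc : F.map (U.map (adj.counit.app B)) ≫ c.π = adj.counit.app (F.obj (U.obj B)) ≫ c.π :=
    c.condition
  -- After precomposition with the epi `adj.counit.app r.W`, the map `t ≫ c.π` depends only on `t ≫
  -- adj.counit.app B`; hence `c.π` coequalizes any pair that the counit at `B` coequalizes.
  have key : ∀ t : r.W ⟶ F.obj (U.obj B),
      adj.counit.app r.W ≫ t ≫ c.π = F.map (U.map (t ≫ adj.counit.app B)) ≫ c.π := by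
    intro t
    have h := adj.counit_naturality_assoc t c.π
    rw [← hc] at h
    rw [U.map_comp, F.map_comp, Category.assoc]
    exact h.symm
  have hw : r.left ≫ c.π = r.right ≫ c.π := by
    rw [← cancel_epi (adj.counit.app r.W)]
    refine (key _).trans (Eq.trans ?_ (key _).symm)
    exact congrArg (fun t => F.map (U.map t) ≫ c.π) r.w
  have hd : adj.counit.app B ≫ Cofork.IsColimit.desc r.isColimit c.π hw = c.π :=
    Cofork.IsColimit.π_desc r.isColimit
  exact ⟨Cofork.IsColimit.desc r.isColimit c.π hw, hd,
    fun {m} hm => Cofork.IsColimit.hom_ext r.isColimit (hm.trans hd.symm)⟩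

theorem homEquiv_counit_comp (adj : F ⊣ U) {X Y : C} (g : X ⟶ Y) :
    adj.homEquiv (U.obj X) Y (adj.counit.app X ≫ g) = U.map g := by
  simp [Adjunction.homEquiv_unit]

/-- A category with coequalizers and a right adjoint functor to the category of sets is a
quasivariety if the counit consists of regular epis and the functor sends regular epis to
surjections. -/
theorem isQuasivariety_of_adjunction [HasCoequalizers C] (adj : F ⊣ U)
    (hU : ∀ {X Y : C} (f : X ⟶ Y), IsRegularEpi f → Function.Surjective (U.map f))
    (hε : ∀ B, IsRegularEpi (adj.counit.app B)) : IsQuasivariety.{u} C := by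
  let K := Monad.comparison adj
  let adjK :=
    MonadicityInternal.comparisonAdjunction adj
  have hiso : ∀ B, IsIso (adjK.counit.app B) := fun B => by
    rw [MonadicityInternal.comparisonAdjunction_counit_app]
    exact (IsColimit.coconePointUniqueUpToIso (colimit.isColimit _)
      (nonempty_isColimit_counitCofork adj hε B).some).isIso_hom
  have hiso' : IsIso adjK.counit := NatIso.isIso_of_isIso_app _
  have hK := adjK.fullyFaithfulROfIsIsoCounit
  let _ : Reflective K :=
    { toFull := hK.full, toFaithful := hK.faithful, L := _, adj := adjK }
  have hunit : ∀ A, Function.Surjective (adjK.unit.app A).f := fun A b => by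
    -- The unit is the transpose of the coequalizer map `π`, and `U.map π` factors as `A.a` followed
    -- by it; so surjectivity of `U.map π` suffices.
    rw [MonadicityInternal.comparisonAdjunction_unit_f_aux]
    obtain ⟨t, rfl⟩ := hU (coequalizer.π (F.map A.a) (adj.counit.app (F.obj A.A)))
      ⟨⟨coequalizerRegular _ _⟩⟩ b
    refine ⟨A.a t, ?_⟩
    have h : A.a ≫ adj.homEquiv A.A _ (coequalizer.π (F.map A.a) (adj.counit.app (F.obj A.A))) =
        U.map (coequalizer.π (F.map A.a) (adj.counit.app (F.obj A.A))) := by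
      refine ((adj.homEquiv_naturality_left A.a _).symm.trans
        (congrArg _ (coequalizer.condition _ _))).trans ?_
      exact homEquiv_counit_comp adj _
    exact ConcreteCategory.congr_hom h t
  let e := equivEssImageOfReflective (i := K)
  let _ := reflectiveEssImage K
  refine ⟨adj.toMonad.Algebra, inferInstance, adj.toMonad.forget, inferInstance, K.essImage,
    inferInstance, inferInstance, fun A => isRegularEpi_of_surjective _ ?_, ⟨e⟩⟩
  rw [reflectiveEssImage_unit_app]
  exact hunit A

end

/-! ### Separated Cauchy-complete categories: powers and closed subcategories -/

section

variable {V : Type u} [CommMonoid V] [CompleteLattice V] [IsQuantale V]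

namespace VCat

theorem IsAdjointPair.left_eq_iInf {X : VCat V} {φ ψ : X.carrier → V} (h : IsAdjointPair X φ ψ)
    (y : X.carrier) : φ y = ⨅ z, ψ z ⇨ᵣ X.hom z y := by
  apply le_antisymm (le_iInf_res.2 fun z => h.counit z y)
  refine (le_mul_of_one_le' h.unit).trans ?_
  rw [iSup_mul']
  refine iSup_le fun z => ?_
  rw [mul_assoc]
  exact (mul_le_mul_right (le_iInf_res.1 le_rfl z) _).trans (h.map_left z y)

/-- The point `x` is the colimit of the identity weighted by `ψ`, and by `left_eq_iInf` a left
adjoint of `ψ` must be `X(x, -)`. -/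
theorem isCauchyComplete_of_exists {X : VCat V}
    (h : ∀ ψ : X.carrier → V, ∃ x, ∀ y, X.hom x y = ⨅ z, ψ z ⇨ᵣ X.hom z y) :
    X.IsCauchyComplete :=
  isCauchyComplete_iff.2 fun φ ψ hφ => by
    obtain ⟨x, hx⟩ := h ψ
    exact ⟨x, funext fun y => (hφ.left_eq_iInf y).trans (hx y).symm⟩

theorem iSup_mul_res {ι : Sort*} (f g : ι → V) (t : V) :
    (⨆ i, f i * g i) ⇨ᵣ t = ⨅ i, f i ⇨ᵣ (g i ⇨ᵣ t) := by
  refine eq_of_forall_le_iff fun c => ?_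
  rw [le_res_iff, le_iInf_res, iSup_mul', iSup_le_iff]
  refine forall_congr' fun i => ?_
  rw [le_res_iff, mul_assoc, mul_left_comm]

theorem res_iInf {ι : Sort*} (a : V) (f : ι → V) : a ⇨ᵣ (⨅ i, f i) = ⨅ i, a ⇨ᵣ f i := by
  refine eq_of_forall_le_iff fun c => ?_
  rw [le_res_iff, le_iInf_res, le_iInf_iff]

theorem isSepCC_power (I : Type u) : isSepCC V (power V I) := by
  refine ⟨fun s t hst hts => le_antisymm (α := I → V) (power_sep hst) (power_sep hts),
    isCauchyComplete_of_exists fun (ψ : (I → V) → V) => ⟨fun i => ⨆ s : I → V, ψ s * s i,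
      fun t => ?_⟩⟩
  refine (iInf_congr fun i => iSup_mul_res ψ (fun s => s i) (t i)).trans ?_
  rw [iInf_comm]
  exact iInf_congr fun s => (res_iInf _ _).symm

theorem isSepCC_base : isSepCC V (base V) := by
  have key : ∀ s t : V, 1 ≤ s ⇨ᵣ t → s ≤ t := fun s t h => by simpa [le_res_iff] using h
  exact ⟨fun s t hst hts => le_antisymm (α := V) (key _ _ hst) (key _ _ hts),
    isCauchyComplete_of_exists fun (ψ : V → V) => ⟨(⨆ s : V, ψ s * s : V), fun t =>
      iSup_mul_res ψ id t⟩⟩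

/-- Extend an adjoint pair from `M` to `X` along the inclusion. The point representing it there lies
in the closure of `M` by the original unit, hence in `M`. -/
theorem isSepCC_full {X : VCat V} (hX : isSepCC V X) {M : Set X.carrier} (hM : X.closure M ⊆ M) :
    isSepCC V (X.full M) := by
  refine ⟨fun x y h h' => Subtype.ext (hX.1 _ _ h h'), isCauchyComplete_iff.2 fun φ ψ h => ?_⟩
  have hφ : ∀ e : M, φ e ≤ ⨆ e' : M, φ e' * X.hom e' e := fun e =>
    le_iSup_of_le (f := fun e' : M => φ e' * X.hom e' e) e (le_mul_of_one_le (X.one_le _))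
  have hψ : ∀ e : M, ψ e ≤ ⨆ e' : M, X.hom e e' * ψ e' := fun e =>
    le_iSup_of_le (f := fun e' : M => X.hom e e' * ψ e') e (le_mul_of_one_le' (X.one_le _))
  have hX' : IsAdjointPair X (fun x => ⨆ e : M, φ e * X.hom e x)
      (fun x => ⨆ e : M, X.hom x e * ψ e) :=
    { map_left := fun x y => by
        rw [iSup_mul']
        refine iSup_mono fun e => ?_
        rw [mul_assoc]
        exact mul_le_mul_right (X.comp_le _ _ _) _
      map_right := fun x y => by
        rw [mul_comm, iSup_mul']
        refine iSup_mono fun e => ?_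
        rw [mul_comm, ← mul_assoc]
        exact mul_le_mul_left (X.comp_le _ _ _) _
      unit := h.unit.trans (iSup_le fun e => le_iSup_of_le e.1 (mul_le_mul' (hφ e) (hψ e)))
      counit := fun x y => by
        rw [iSup_mul']
        refine iSup_le fun e => ?_
        rw [mul_comm, iSup_mul']
        refine iSup_le fun e' => ?_
        calc φ e' * X.hom e' y * (X.hom x e * ψ e)
            = X.hom x e * (ψ e * φ e' * X.hom e' y) := by ac_rfl
          _ ≤ X.hom x e * (X.hom e e' * X.hom e' y) :=
            mul_le_mul_right (mul_le_mul_left (h.counit e e') _) _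
          _ ≤ X.hom x e * X.hom e y := mul_le_mul_right (X.comp_le _ _ _) _
          _ ≤ X.hom x y := X.comp_le _ _ _ }
  obtain ⟨x, hx⟩ := isCauchyComplete_iff.1 hX.2 _ _ hX'
  have hx' := hX'.right_eq hx
  have hxM : x ∈ X.closure M := h.unit.trans (iSup_mono fun e => mul_le_mul'
    ((hφ e).trans (congrFun hx e.1).le) ((hψ e).trans (hx' e.1).le))
  refine ⟨⟨x, hM hxM⟩, funext fun e => le_antisymm ((hφ e).trans (congrFun hx e.1).le)
    ((congrFun hx e.1).ge.trans (iSup_le fun e' => h.map_left e' e))⟩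

/-- For each `z`, the functors `Y(z, f -)` and `Y(z, g -)` agree on the equalizer, hence on its
closure; separatedness of `Y` concludes. -/
theorem closure_equalizer_subset {X Y : VCat V} (hY : Y.IsSeparated) (f g : X ⟶ Y) :
    X.closure {x | f.toFun x = g.toFun x} ⊆ {x | f.toFun x = g.toFun x} := by
  intro y hy
  have key : ∀ z, Y.hom z (f.toFun y) = Y.hom z (g.toFun y) := fun z => by
    refine eq_of_mem_closure hy
      (φ := fun x => Y.hom z (f.toFun x)) (ψ := fun x => Y.hom z (g.toFun x)) ?_ ?_
      fun x hx => congrArg (Y.hom z) hx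
    · exact fun x x' => (f.isVFunctor x x').trans (Y.isVFunctor_hom z _ _)
    · exact fun x x' => (g.isVFunctor x x').trans (Y.isVFunctor_hom z _ _)
  exact hY _ _ ((Y.one_le _).trans (key _).le) ((Y.one_le _).trans (key _).ge)

end VCat

/-! ### The dual of separated Cauchy-complete categories is a quasivariety -/

open Limits Opposite

variable (V) in
/-- The category of separated Cauchy complete `V`-categories. -/
abbrev SepCCVCat := (isSepCC V).FullSubcategory

namespace SepCCVCat

variable {X Y : SepCCVCat V}

/-- Morphisms of separated Cauchy complete `V`-categories from functions. -/
def ofFun (f : X.obj.carrier → Y.obj.carrier) (hf : IsVFunctor X.obj Y.obj f) : X ⟶ Y :=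
  ObjectProperty.homMk ⟨f, hf⟩

theorem hom_ext {f g : X ⟶ Y} (h : ∀ x, f.hom.toFun x = g.hom.toFun x) : f = g :=
  ObjectProperty.hom_ext _ (VCat.Hom.ext (funext h))

theorem congr_toFun {f g : X ⟶ Y} (h : f = g) (x : X.obj.carrier) :
    f.hom.toFun x = g.hom.toFun x :=
  congrArg (fun k => k.hom.toFun x) h

/-- The equalizer of two morphisms, as a full subcategory. -/
def equalizerObj (f g : X ⟶ Y) : SepCCVCat V :=
  ⟨X.obj.full {x | f.hom.toFun x = g.hom.toFun x},
    isSepCC_full X.property (closure_equalizer_subset Y.property.1 f.hom g.hom)⟩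

/-- The equalizer of two morphisms. -/
def equalizerFork (f g : X ⟶ Y) : Fork f g :=
  Fork.ofι (P := equalizerObj f g) (ofFun (fun x => x.1) fun _ _ => le_rfl)
    (hom_ext fun x => x.2)

/-- The universal property of the equalizer. -/
def isLimitEqualizerFork (f g : X ⟶ Y) : IsLimit (equalizerFork f g) :=
  Fork.IsLimit.mk' _ fun s =>
    ⟨ofFun (X := s.pt) (Y := equalizerObj f g)
      (fun z => ⟨s.ι.hom.toFun z, congr_toFun s.condition z⟩)
      s.ι.hom.isVFunctor, rfl, fun hm => hom_ext fun z => Subtype.ext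
        (congr_toFun hm z)⟩

instance : HasEqualizers (SepCCVCat V) :=
  haveI : ∀ {X Y : SepCCVCat V} {f g : X ⟶ Y}, HasLimit (parallelPair f g) :=
    ⟨⟨_, isLimitEqualizerFork _ _⟩⟩
  hasEqualizers_of_hasLimit_parallelPair _

/-- The concrete equalizer carries the hom of `Y` and factors through `m`; functoriality of the
factorization `l` is the missing inequality. -/
theorem isFullyFaithful_of_isRegularMono (m : X ⟶ Y) (hm : IsRegularMono m) :
    IsFullyFaithful m.hom := by
  obtain ⟨⟨r⟩⟩ := hm
  have hmono : Mono m := r.mono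
  let e : X ⟶ equalizerObj r.left r.right :=
    ofFun (fun x => ⟨m.hom.toFun x, congr_toFun r.w x⟩) m.hom.isVFunctor
  let l : equalizerObj r.left r.right ⟶ X :=
    Fork.IsLimit.lift r.isLimit (equalizerFork r.left r.right).ι (equalizerFork _ _).condition
  have hl : l ≫ m = (equalizerFork r.left r.right).ι := Fork.IsLimit.lift_ι r.isLimit
  have hel : e ≫ l = 𝟙 X := by
    rw [← cancel_mono m, Category.assoc, hl, Category.id_comp]
    rfl
  intro x x'
  have h : ∀ x, l.hom.toFun (e.hom.toFun x) = x := congr_toFun hel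
  have h1 := l.hom.isVFunctor (e.hom.toFun x) (e.hom.toFun x')
  rw [h, h] at h1
  exact le_antisymm h1 (m.hom.isVFunctor x x')

variable (V) in
/-- The quantale `V` as a separated Cauchy complete `V`-category. -/
def ofBase : SepCCVCat V := ⟨base V, isSepCC_base⟩

variable (V) in
/-- The powers of `V` as separated Cauchy complete `V`-categories. -/
def ofPower (I : Type u) : SepCCVCat V := ⟨power V I, isSepCC_power I⟩

theorem isVFunctor_power_iff {X : VCat V} {I : Type u} {f : X.carrier → I → V} :
    IsVFunctor X (power V I) f ↔ ∀ i, IsVFunctor X (base V) (fun x => f x i) := by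
  simp only [IsVFunctor]
  constructor
  · exact fun h i x x' => (h x x').trans (iInf_le _ i)
  · exact fun h x x' => le_iInf fun i => h i x x'

theorem isRegularMono_of_isFullyFaithful (m : X ⟶ Y) (hm : IsFullyFaithful m.hom) :
    IsRegularMono m := by
  -- All pairs of functors to `V` that agree on `m`, bundled into one pair `Y ⟶ V ^ J`: its
  -- equalizer is the Zariski closure of the image of `m`, which is the image itself.
  let J : Type u := {p : (Y ⟶ ofBase V) × (Y ⟶ ofBase V) // m ≫ p.1 = m ≫ p.2}
  let f : Y ⟶ ofPower V J := ofFun (fun y p => p.1.1.hom.toFun y)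
    (isVFunctor_power_iff.2 fun p => p.1.1.hom.isVFunctor)
  let g : Y ⟶ ofPower V J := ofFun (fun y p => p.1.2.hom.toFun y)
    (isVFunctor_power_iff.2 fun p => p.1.2.hom.isVFunctor)
  have hw : m ≫ f = m ≫ g := hom_ext fun x => funext fun p =>
    congr_toFun p.2 x
  have hinj := hm.injective X.property.1
  refine ⟨⟨⟨ofPower V J, f, g, hw, Fork.IsLimit.mk' _ fun s => ?_⟩⟩⟩
  have hs : ∀ z, ∃ x, m.hom.toFun x = s.ι.hom.toFun z := fun z => by
    refine X.property.2.closure_range_subset Y.property.1 hm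
      (mem_closure_iff.2 fun φ ψ hφ hψ h => ?_)
    have h1 : s.ι.hom.toFun z ∈ {y | f.hom.toFun y = g.hom.toFun y} :=
      congr_toFun s.condition z
    exact congrFun h1 ⟨(ofFun (Y := ofBase V) φ hφ, ofFun (Y := ofBase V) ψ hψ),
      hom_ext fun x => h _ ⟨x, rfl⟩⟩
  choose k hk using hs
  refine ⟨ofFun k fun z z' => ?_, hom_ext hk, fun {l} hl => hom_ext fun z => hinj ?_⟩
  · refine le_of_le_of_eq ?_ (hm (k z) (k z'))
    rw [hk, hk]
    exact s.ι.hom.isVFunctor z z'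
  · exact (congr_toFun hl z).trans (hk z).symm

variable (V) in
/-- The functor sending a set `I` to the power `V ^ I`. -/
def powerFunctor : Type u ⥤ (SepCCVCat V)ᵒᵖ where
  obj I := op (ofPower V I)
  map {I J} f := Quiver.Hom.op (ofFun (X := ofPower V J) (Y := ofPower V I) (fun s i => s (f i))
    (isVFunctor_power_iff.2 fun i _ _ => iInf_le _ (f i)))

variable (V) in
/-- The functor sending a separated Cauchy complete `V`-category to the set of its functors to
`V`, whose left adjoint is given by the powers of `V`. -/
def powerAdjunction : powerFunctor V ⊣ yoneda.obj (ofBase V) :=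
  Adjunction.mkOfHomEquiv
    { homEquiv := fun I X =>
        { toFun := fun f => TypeCat.ofHom fun i =>
            ofFun (X := X.unop) (Y := ofBase V) (fun x => f.unop.hom.toFun x i)
              (isVFunctor_power_iff.1 f.unop.hom.isVFunctor i)
          invFun := fun g => Quiver.Hom.op (ofFun (X := X.unop) (Y := ofPower V I)
            (fun x i => (g i).hom.toFun x) (isVFunctor_power_iff.2 fun i => (g i).hom.isVFunctor))
          left_inv := fun _ => rfl
          right_inv := fun _ => rfl }
      homEquiv_naturality_left_symm := fun _ _ => rfl
      homEquiv_naturality_right := fun _ _ => rfl }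

theorem isFullyFaithful_counit (X : (SepCCVCat V)ᵒᵖ) :
    IsFullyFaithful ((powerAdjunction V).counit.app X).unop.hom := by
  intro x x'
  refine le_antisymm ?_ (((powerAdjunction V).counit.app X).unop.hom.isVFunctor x x')
  -- The counit is evaluation `X ⟶ V ^ Hom(X, V)`; the coordinate `X(x, -)` already bounds the hom
  -- of the power by `X(x, x')`.
  let φ : X.unop ⟶ ofBase V := ofFun (X.unop.obj.hom x) (X.unop.obj.isVFunctor_hom x)
  refine (iInf_le _ φ).trans ?_
  exact (le_mul_of_one_le' (X.unop.obj.one_le x)).trans (le_res_iff.1 le_rfl)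

theorem surjective_map_of_isRegularEpi {X Y : (SepCCVCat V)ᵒᵖ} (f : X ⟶ Y) (hf : IsRegularEpi f) :
    Function.Surjective ((yoneda.obj (ofBase V)).map f) := by
  intro φ
  have hm := isFullyFaithful_of_isRegularMono f.unop ((isRegularMono_unop_iff_isRegularEpi f).2 hf)
  obtain ⟨ψ, hψ, h⟩ := hm.exists_extension φ.hom.isVFunctor
  exact ⟨ofFun ψ hψ, hom_ext fun x => (congrFun h x).symm⟩

theorem isQuasivariety_op : IsQuasivariety.{u} (SepCCVCat V)ᵒᵖ :=
  isQuasivariety_of_adjunction (powerAdjunction V) surjective_map_of_isRegularEpi fun X =>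
    (isRegularMono_unop_iff_isRegularEpi _).1
      (isRegularMono_of_isFullyFaithful _ (isFullyFaithful_counit X))

end SepCCVCat

end

theorem mainTheorem5 (V : Type u) [CommMonoid V] [CompleteLattice V] [IsQuantale V] :
    (vcatToAfSet V ⋙ afSetToVCat V = 𝟭 (VCat V) ∧ afSetToVCat V ⋙ vcatToAfSet V = 𝟭 (AfSet V)) ∧
    (∀ X : AfSet V, X.IsAlgebraic ↔
      ((afSetToVCat V).obj X).IsSeparated ∧ ((afSetToVCat V).obj X).IsCauchyComplete) ∧
    IsQuasivariety.{u} ((VCat.isSepCC V).FullSubcategory)ᵒᵖ :=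
  ⟨⟨vcatToAfSet_comp_afSetToVCat, afSetToVCat_comp_vcatToAfSet⟩, isAlgebraic_iff,
    SepCCVCat.isQuasivariety_op⟩
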